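/- Let $\mathbb{F}_q$ be a finite field with $q$ elements and let $M\ge 1$ be an integer. For a multisequence $a=(a_{n,m})_{n\ge 1,\,1\le m\le M}\in(\mathbb{F}_q^M)^\infty$ and $n\ge 0$, let $L_a(n)$ be the (joint) linear complexity of the first $n$ columns of $a$, that is, the least $l\ge 0$ for which there are coefficients $\alpha_0,\dots,\alpha_{l-1}\in\mathbb{F}_q$ with \[a_{k+l,m}=\sum_{i=0}^{l-1}\alpha_i\,a_{k+i,m}\qquad\text{for all } 1\le k\le n-l \text{ and all } 1\le m\le M\] (a single linear feedback shift register of length $l$ produces the first $n$ terms of all $M$ sequences, with suitable initial contents). Then for almost every $a\in(\mathbb{F}_q^M)^\infty$, with respect to the normalized Haar measure on the compact additive group $(\mathbb{F}_q^M)^\infty$ (product of discrete topologies), we have \[\liminf_{n\to\infty}\frac{L_a(n)}{n}=\limsup_{n\to\infty}\frac{L_a(n)}{n}=\lim_{n\to\infty}\frac{L_a(n)}{n}=\frac{M}{M+1}.\] -/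

import Mathlib

/-- A single linear feedback shift register of length `l` over `F`, with feedback coefficients
`c 0, …, c (l - 1)`, produces the first `n` columns of the multisequence `a` (all `M` rows at
once, each row `m` from its own initial content `a 0 m, …, a (l - 1) m`).
Columns are indexed from `0`, so the first `n` columns are `a 0, …, a (n - 1)`.
For `l = 0` this says that the first `n` columns are zero. -/
def IsLFSRLength {F : Type*} [Field F] {M : ℕ} (a : ℕ → Fin M → F) (n l : ℕ) : Prop :=
  ∃ c : Fin l → F, ∀ k : ℕ, k + l < n → ∀ m : Fin M,
    a (k + l) m = ∑ i : Fin l, c i * a (k + (i : ℕ)) m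

theorem exists_isLFSRLength {F : Type*} [Field F] {M : ℕ} (a : ℕ → Fin M → F) (n : ℕ) :
    ∃ l : ℕ, IsLFSRLength a n l :=
  ⟨n, fun _ => 0, fun k hk => absurd hk (by omega)⟩

open Classical in
/-- The (joint) linear complexity `L_a(n)` of the multisequence `a`: the least length of a single
linear feedback shift register producing the first `n` columns of `a`. -/
noncomputable def linearComplexity {F : Type*} [Field F] {M : ℕ} (a : ℕ → Fin M → F) (n : ℕ) : ℕ :=
  Nat.find (exists_isLFSRLength a n)

/-- The Haar measure on the compact additive group `(F ^ M) ^ ∞` of all multisequences (product of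
the discrete topologies), normalised to total mass `1`. -/
noncomputable def haarMultisequence (F : Type*) [Field F] [Finite F] [TopologicalSpace F]
    [DiscreteTopology F] [MeasurableSpace F] [BorelSpace F] (M : ℕ) :
    MeasureTheory.Measure (ℕ → Fin M → F) :=
  MeasureTheory.Measure.addHaarMeasure (⊤ : TopologicalSpace.PositiveCompacts (ℕ → Fin M → F))

open MeasureTheory Filter

/-! ### Linear recurrences and block Hankel systems. -/

section LinearRecurrence

/-! Put n = l + p and q = |F|. Each of the q^l coefficient vectors imposes Mp independent linear
conditions on a, so P(L(n) ≤ l) ≤ q^(l - Mp) by a union bound. If no vector works, an Mp × l linear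
system is inconsistent, so one of fewer than q^(Mp) nontrivial row combinations vanishes, each with
probability q^(-l); hence P(L(n) > l) ≤ q^(Mp - l). Both exponents change sign at l = Mn/(M+1). A
deviation of εn has probability at most a constant times q^(-(M+1)εn), which is summable, and
Borel–Cantelli concludes. -/

theorem exists_linearRecurrence_solution {F : Type*} [Field F] (v : ℕ → F) (d : ℕ)
    (hv : v d ≠ 0) (y : ℕ → F) :
    ∃ b : ℕ → F, ∀ i, ∑ k ∈ Finset.range (d + 1), v k * b (i + k) = y i := by
  -- The first `d` terms are free and set to 0; each later term is solved for using the invertible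
  -- leading coefficient.
  let step : (n : ℕ) → ((m : ℕ) → m < n → F) → F := fun n b =>
    if h : d ≤ n then
      (v d)⁻¹ * (y (n - d) - ∑ k : Fin d, v k * b (n - d + k) (by omega))
    else 0
  let b : ℕ → F := fun n => Nat.strongRec (motive := fun _ => F) step n
  have hb : ∀ n, b n = step n (fun m _ => b m) := fun n => by
    simp only [b]
    rw [Nat.strongRec_eq]
  refine ⟨b, fun i => ?_⟩
  have h := hb (i + d)
  simp only [step, Nat.le_add_left, dite_true, Nat.add_sub_cancel] at h
  rw [Finset.sum_range_succ, h, mul_inv_cancel_left₀ hv,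
    Finset.sum_range (fun k => v k * b (i + k))]
  ring

variable {F : Type*} [Field F] {M : ℕ}

theorem IsLFSRLength.succ {a : ℕ → Fin M → F} {n l : ℕ} (h : IsLFSRLength a n l) :
    IsLFSRLength a n (l + 1) := by
  obtain ⟨c, hc⟩ := h
  refine ⟨Fin.cons 0 c, fun k hk m => ?_⟩
  rw [Fin.sum_univ_succ]
  have := hc (k + 1) (by omega) m
  simp only [Fin.cons_zero, zero_mul, zero_add, Fin.cons_succ, Fin.val_succ]
  rw [show k + (l + 1) = k + 1 + l by omega, this]
  exact Finset.sum_congr rfl fun i _ => by rw [show k + 1 + (i : ℕ) = k + (i + 1) by omega]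

theorem IsLFSRLength.mono {a : ℕ → Fin M → F} {n l l' : ℕ} (h : IsLFSRLength a n l)
    (hl : l ≤ l') : IsLFSRLength a n l' := by
  induction l', hl using Nat.le_induction with
  | base => exact h
  | succ _ _ ih => exact ih.succ

theorem linearComplexity_le_iff {a : ℕ → Fin M → F} {n l : ℕ} :
    linearComplexity a n ≤ l ↔ IsLFSRLength a n l := by
  classical
  unfold linearComplexity
  constructor
  · intro h
    exact (Nat.find_spec (exists_isLFSRLength a n)).mono (by convert h)
  · intro h
    convert Nat.find_min' (exists_isLFSRLength a n) h

theorem linearComplexity_le (a : ℕ → Fin M → F) (n : ℕ) : linearComplexity a n ≤ n :=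
  linearComplexity_le_iff.2 ⟨fun _ => 0, fun _ hk => absurd hk (by omega)⟩

/-- The defect of the linear recurrence with coefficients `c` on the first `l + p` columns. -/
def recurrenceDefect (M : ℕ) {l : ℕ} (p : ℕ) (c : Fin l → F) :
    (ℕ → Fin M → F) →+ (Fin p × Fin M → F) where
  toFun a j := a (j.1 + l) j.2 - ∑ i : Fin l, c i * a (j.1 + i) j.2
  map_zero' := by ext; simp
  map_add' a b := by
    ext
    simp only [Pi.add_apply, mul_add, Finset.sum_add_distrib]
    ring

theorem recurrenceDefect_surjective {l : ℕ} (p : ℕ) (c : Fin l → F) :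
    Function.Surjective (recurrenceDefect M p c) := by
  intro y
  -- The recurrence is monic, so each row can be solved separately for any right-hand side.
  let v : ℕ → F := fun k => if h : k < l then -c ⟨k, h⟩ else 1
  have key : ∀ m : Fin M, ∃ b : ℕ → F, ∀ i, ∑ k ∈ Finset.range (l + 1), v k * b (i + k) =
      if h : i < p then y (⟨i, h⟩, m) else 0 := fun m =>
    exists_linearRecurrence_solution v l (by simp [v]) _
  choose b hb using key
  refine ⟨fun k m => b m k, ?_⟩
  ext ⟨i, m⟩
  have h := hb m i
  rw [Finset.sum_range_succ, Finset.sum_range (fun k => v k * b m (i + k))] at h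
  simp only [v, Fin.is_lt, dite_true, lt_irrefl, dite_false, one_mul, Fin.eta, neg_mul,
    Finset.sum_neg_distrib] at h
  change b m (i + l) - ∑ j : Fin l, c j * b m (i + j) = _
  rw [← h]
  ring

theorem isLFSRLength_add_iff {a : ℕ → Fin M → F} {p l : ℕ} :
    IsLFSRLength a (l + p) l ↔ ∃ c : Fin l → F, recurrenceDefect M p c a = 0 := by
  refine exists_congr fun c => ⟨fun h => ?_, fun h k hk m => ?_⟩
  · ext ⟨k, m⟩
    exact sub_eq_zero.2 (h k (by omega) m)
  · exact sub_eq_zero.1 (congrFun h (⟨k, by omega⟩, m))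

/-- The combination with weights `u` of the rows of the `l`-column block Hankel matrix of a
multisequence. -/
def hankelCombination (l : ℕ) {p : ℕ} (u : Fin p × Fin M → F) :
    (ℕ → Fin M → F) →+ (Fin l → F) where
  toFun a i := ∑ j, u j * a (j.1 + i) j.2
  map_zero' := by ext; simp
  map_add' a b := by
    ext
    simp only [Pi.add_apply, mul_add, Finset.sum_add_distrib]

/-- One row `m₀` on which `u` is nonzero suffices: the last nonzero weight there leads a solvable
recurrence, and all other rows are set to 0. -/
theorem hankelCombination_surjective (l : ℕ) {p : ℕ} {u : Fin p × Fin M → F} (hu : u ≠ 0) :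
    Function.Surjective (hankelCombination l u) := by
  classical
  intro y
  obtain ⟨⟨k₀, m₀⟩, h₀⟩ := Function.ne_iff.1 hu
  let s : Finset (Fin p) := Finset.univ.filter fun k => u (k, m₀) ≠ 0
  have hs : s.Nonempty := ⟨k₀, by simpa [s] using h₀⟩
  let d := s.max' hs
  have hd : u (d, m₀) ≠ 0 := by simpa [s] using s.max'_mem hs
  let v : ℕ → F := fun k => if h : k < p then u (⟨k, h⟩, m₀) else 0
  have hvd : v d = u (d, m₀) := by simp [v]
  obtain ⟨b, hb⟩ := exists_linearRecurrence_solution v d (hvd ▸ hd)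
    (fun i => if h : i < l then y ⟨i, h⟩ else 0)
  refine ⟨fun k m => if m = m₀ then b k else 0, ?_⟩
  ext i
  have h := hb i
  simp only [Fin.is_lt, dite_true, Fin.eta] at h
  rw [← h]
  change ∑ j : Fin p × Fin M, u j * (if j.2 = m₀ then b (j.1 + i) else 0) = _
  rw [Fintype.sum_prod_type]
  simp only [mul_ite, mul_zero, Finset.sum_ite_eq', Finset.mem_univ, if_true]
  have h1 : ∀ k : Fin p, u (k, m₀) * b (k + i) = v k * b (i + k) := fun k => by
    simp [v, add_comm]
  rw [Finset.sum_congr rfl fun k _ => h1 k, ← Finset.sum_range (fun k => v k * b (i + k))]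
  symm
  refine Finset.sum_subset (Finset.range_subset_range.2 d.2) fun k hk hkd => ?_
  rw [Finset.mem_range] at hk hkd
  have : v k = 0 := by
    by_contra hne
    have hmem : (⟨k, hk⟩ : Fin p) ∈ s := by simpa [s, v, hk] using hne
    have := Fin.le_def.1 (s.le_max' _ hmem)
    exact hkd (Nat.lt_succ_of_le this)
  rw [this, zero_mul]

/-- Without a solution `c`, the range of the Hankel map is proper, so a nonzero functional kills it;
its coordinates are `u`. -/
theorem exists_hankelCombination_eq_zero {a : ℕ → Fin M → F} {p l : ℕ}
    (h : ¬ IsLFSRLength a (l + p) l) :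
    ∃ u : Fin p × Fin M → F, u ≠ 0 ∧ hankelCombination l u a = 0 := by
  classical
  let T : (Fin l → F) →ₗ[F] (Fin p × Fin M → F) :=
    { toFun := fun c j => ∑ i : Fin l, c i * a (j.1 + i) j.2
      map_add' := fun c d => by
        ext
        simp only [Pi.add_apply, add_mul, Finset.sum_add_distrib]
      map_smul' := fun r c => by
        ext
        simp only [Pi.smul_apply, smul_eq_mul, mul_assoc, Finset.mul_sum, RingHom.id_apply] }
  have hT : LinearMap.range T < ⊤ := by
    refine lt_top_iff_ne_top.2 fun htop => h ?_
    obtain ⟨c, hc⟩ := LinearMap.range_eq_top.1 htop fun j => a (j.1 + l) j.2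
    exact ⟨c, fun k hk m => (congrFun hc (⟨k, by omega⟩, m)).symm⟩
  obtain ⟨f, hf, hfT⟩ := Submodule.exists_le_ker_of_lt_top _ hT
  have hsum : ∀ w, f w = ∑ j, f (Pi.single j 1) * w j := fun w => by
    conv_lhs => rw [pi_eq_sum_univ' w]
    simp [map_sum, mul_comm]
  refine ⟨fun j => f (Pi.single j 1), fun hu => hf ?_, ?_⟩
  · ext w
    simpa using congrFun hu w
  · ext i
    have h0 : f (T (Pi.single i 1)) = 0 := hfT ⟨_, rfl⟩
    rw [hsum] at h0
    simpa [T, Pi.single_apply, hankelCombination] using h0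

end LinearRecurrence

/-! ### Measure of the kernel of a homomorphism onto a finite group. -/

section InvariantMeasure

/-- The fibres are translates of the kernel, so they share the total mass 1 equally. -/
theorem measureReal_ker_mul_card {G H : Type*} [AddGroup G] [MeasurableSpace G]
    [MeasurableAdd G] [AddGroup H] [Finite H] (μ : Measure G) [IsProbabilityMeasure μ]
    [μ.IsAddLeftInvariant] (φ : G →+ H) (hφ : Function.Surjective φ)
    (hm : MeasurableSet {x | φ x = 0}) :
    μ.real {x | φ x = 0} * Nat.card H = 1 := by
  have := Fintype.ofFinite H
  choose g hg using hφ
  have hpre : ∀ y, {x | φ x = y} = (fun x => -g y + x) ⁻¹' {x | φ x = 0} := fun y => by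
    ext x
    simp only [Set.mem_ofPred_eq, Set.mem_preimage, map_add, map_neg, hg, neg_add_eq_zero]
    exact eq_comm
  have hmeas : ∀ y, MeasurableSet {x | φ x = y} := fun y => by
    rw [hpre]
    exact measurable_const_add _ hm
  have hval : ∀ y, μ.real {x | φ x = y} = μ.real {x | φ x = 0} := fun y => by
    rw [hpre, measureReal_def, measure_preimage_add, measureReal_def]
  have hunion : (⋃ y ∈ (Finset.univ : Finset H), {x | φ x = y}) = Set.univ := by
    ext
    simp
  have h1 := measureReal_biUnion_finset (μ := μ) (s := (Finset.univ : Finset H))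
    (f := fun y => {x | φ x = y})
    (fun y _ z _ hyz => Set.disjoint_left.2 fun x hx hx' => hyz (hx.symm.trans hx'))
    (fun y _ => hmeas y)
  rw [hunion, probReal_univ, Finset.sum_congr rfl fun y _ => hval y] at h1
  rw [h1, Finset.sum_const, nsmul_eq_mul, Finset.card_univ, Nat.card_eq_fintype_card, mul_comm]

end InvariantMeasure

/-! ### Tail bounds for the linear complexity and Borel–Cantelli. -/

section Haar

variable {F : Type*} [Field F] [Finite F] [TopologicalSpace F] [DiscreteTopology F]
  [MeasurableSpace F] [BorelSpace F] {M : ℕ}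

instance : IsProbabilityMeasure (haarMultisequence F M) :=
  ⟨Measure.addHaarMeasure_self (K₀ := (⊤ : TopologicalSpace.PositiveCompacts (ℕ → Fin M → F)))⟩

instance : (haarMultisequence F M).IsAddLeftInvariant :=
  inferInstanceAs (Measure.addHaarMeasure _).IsAddLeftInvariant

theorem measurableSet_recurrenceDefect_eq_zero {l : ℕ} (p : ℕ) (c : Fin l → F) :
    MeasurableSet {a | recurrenceDefect M p c a = 0} := by
  have : Measurable (recurrenceDefect M p c) := by
    refine measurable_pi_lambda _ fun j => ?_
    change Measurable fun a : ℕ → Fin M → F =>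
      a (j.1 + l) j.2 - ∑ i : Fin l, c i * a (j.1 + i) j.2
    fun_prop
  exact this (measurableSet_singleton 0)

theorem measurableSet_hankelCombination_eq_zero (l : ℕ) {p : ℕ} (u : Fin p × Fin M → F) :
    MeasurableSet {a | hankelCombination l u a = 0} := by
  have : Measurable (hankelCombination l u) := by
    refine measurable_pi_lambda _ fun i => ?_
    change Measurable fun a : ℕ → Fin M → F => ∑ j, u j * a (j.1 + i) j.2
    fun_prop
  exact this (measurableSet_singleton 0)

theorem haar_isLFSRLength_le (l p : ℕ) :
    (haarMultisequence F M).real {a | IsLFSRLength a (l + p) l} ≤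
      (Nat.card F : ℝ) ^ l / (Nat.card F : ℝ) ^ (M * p) := by
  have := Fintype.ofFinite F
  have hq : (0 : ℝ) < Nat.card F := by exact_mod_cast Nat.card_pos
  have hset : {a : ℕ → Fin M → F | IsLFSRLength a (l + p) l} =
      ⋃ c : Fin l → F, {a | recurrenceDefect M p c a = 0} := by
    ext a
    simp [isLFSRLength_add_iff]
  have hval : ∀ c : Fin l → F, (haarMultisequence F M).real {a | recurrenceDefect M p c a = 0} =
      1 / (Nat.card F : ℝ) ^ (M * p) := fun c => by
    rw [eq_div_iff (by positivity), ← measureReal_ker_mul_card (haarMultisequence F M) _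
      (recurrenceDefect_surjective p c) (measurableSet_recurrenceDefect_eq_zero p c)]
    simp [Nat.card_eq_fintype_card, mul_comm]
  rw [hset]
  refine (measureReal_iUnion_fintype_le _).trans (le_of_eq ?_)
  simp [hval, Nat.card_eq_fintype_card, div_eq_mul_inv]

theorem haar_not_isLFSRLength_le (l p : ℕ) :
    (haarMultisequence F M).real {a | ¬ IsLFSRLength a (l + p) l} ≤
      (Nat.card F : ℝ) ^ (M * p) / (Nat.card F : ℝ) ^ l := by
  classical
  have := Fintype.ofFinite F
  have hq : (0 : ℝ) < Nat.card F := by exact_mod_cast Nat.card_pos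
  have hset : {a : ℕ → Fin M → F | ¬ IsLFSRLength a (l + p) l} ⊆
      ⋃ u ∈ (Finset.univ.filter fun u : Fin p × Fin M → F => u ≠ 0),
        {a | hankelCombination l u a = 0} := fun a ha => by
    simpa using exists_hankelCombination_eq_zero ha
  have hval : ∀ u ∈ (Finset.univ.filter fun u : Fin p × Fin M → F => u ≠ 0),
      (haarMultisequence F M).real {a | hankelCombination l u a = 0} =
      1 / (Nat.card F : ℝ) ^ l := fun u hu => by
    rw [eq_div_iff (by positivity), ← measureReal_ker_mul_card (haarMultisequence F M) _
      (hankelCombination_surjective l (Finset.mem_filter.1 hu).2)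
      (measurableSet_hankelCombination_eq_zero l u)]
    simp [Nat.card_eq_fintype_card]
  refine (measureReal_mono hset (measure_ne_top _ _)).trans ((measureReal_biUnion_finset_le _ _).trans ?_)
  rw [Finset.sum_congr rfl hval, Finset.sum_const, nsmul_eq_mul, mul_one_div]
  gcongr
  refine (Nat.cast_le.2 (Finset.card_filter_le _ _)).trans (le_of_eq ?_)
  simp [Nat.card_eq_fintype_card, mul_comm]

theorem pow_div_pow_le_rpow {q : ℝ} (hq : 1 < q) {i j : ℕ} {t : ℝ} (h : (i : ℝ) - j ≤ t) :
    q ^ i / q ^ j ≤ q ^ t := by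
  rw [← Real.rpow_natCast, ← Real.rpow_natCast, ← Real.rpow_sub (by linarith)]
  exact Real.rpow_le_rpow_of_exponent_le hq.le h

theorem ae_eventually_notMem_of_rpow_bound {Ω : Type*} [MeasurableSpace Ω] (μ : Measure Ω)
    [IsFiniteMeasure μ] {q C δ : ℝ} (hq : 1 < q) (hδ : 0 < δ) (s : ℕ → Set Ω)
    (hs : ∀ n, μ.real (s n) ≤ q ^ (C - δ * n)) :
    ∀ᵐ x ∂μ, ∀ᶠ n in atTop, x ∉ s n := by
  have hq0 : 0 < q := by linarith
  have hsum : Summable fun n : ℕ => q ^ (C - δ * n) := by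
    have hr : q ^ (-δ) < 1 := Real.rpow_lt_one_of_one_lt_of_neg hq (by linarith)
    refine ((summable_geometric_of_lt_one (by positivity) hr).mul_left (q ^ C)).congr fun n => ?_
    rw [← Real.rpow_natCast, ← Real.rpow_mul hq0.le, ← Real.rpow_add hq0]
    congr 1
    ring
  refine ae_eventually_notMem (ne_top_of_le_ne_top hsum.tsum_ofReal_ne_top ?_)
  refine ENNReal.tsum_le_tsum fun n => ?_
  rw [← ofReal_measureReal]
  exact ENNReal.ofReal_le_ofReal (hs n)

theorem haar_linearComplexity_lt_le {ε : ℝ} (hε : 0 ≤ ε) (n : ℕ) :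
    (haarMultisequence F M).real
        {a | (linearComplexity a n : ℝ) < ((M : ℝ) / (M + 1) - ε) * n} ≤
      (Nat.card F : ℝ) ^ (((M : ℝ) + 1) - ((M : ℝ) + 1) * ε * n) := by
  have hq : (1 : ℝ) < Nat.card F := by exact_mod_cast Finite.one_lt_card
  have hM : (0 : ℝ) < (M : ℝ) + 1 := by positivity
  set x : ℝ := ((M : ℝ) / (M + 1) - ε) * n with hx
  have hxM : ((M : ℝ) + 1) * x = M * n - (M + 1) * ε * n := by
    rw [hx]
    field_simp
  have hxn : x ≤ n := by
    have h1 : (M : ℝ) / (M + 1) ≤ 1 := (div_le_one hM).2 (by linarith)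
    exact mul_le_of_le_one_left (Nat.cast_nonneg n) (by linarith)
  rcases lt_or_ge x 0 with h0 | h0
  · have hempty : {a : ℕ → Fin M → F | (linearComplexity a n : ℝ) < x} = ∅ :=
      Set.eq_empty_of_forall_notMem fun a ha =>
        absurd (lt_trans ha h0) (not_lt.2 (Nat.cast_nonneg _))
    rw [hempty, measureReal_empty]
    positivity
  · obtain ⟨p, hp⟩ := Nat.exists_eq_add_of_le (Nat.floor_le_of_le hxn)
    have hsub : {a : ℕ → Fin M → F | (linearComplexity a n : ℝ) < x} ⊆
        {a | IsLFSRLength a (⌊x⌋₊ + p) ⌊x⌋₊} := fun a ha => by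
      rw [← hp]
      exact linearComplexity_le_iff.1 (Nat.le_floor (le_of_lt ha))
    refine (measureReal_mono hsub).trans ((haar_isLFSRLength_le _ _).trans
      (pow_div_pow_le_rpow hq ?_))
    have hpn : (n : ℝ) = ⌊x⌋₊ + p := by exact_mod_cast hp
    have := mul_le_mul_of_nonneg_left (Nat.floor_le h0) hM.le
    have hMp : (M : ℝ) * p = M * n - M * ⌊x⌋₊ := by rw [hpn]; ring
    push_cast
    linarith

theorem haar_lt_linearComplexity_le {ε : ℝ} (hε : 0 ≤ ε) (n : ℕ) :
    (haarMultisequence F M).real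
        {a | ((M : ℝ) / (M + 1) + ε) * n < (linearComplexity a n : ℝ)} ≤
      (Nat.card F : ℝ) ^ (((M : ℝ) + 1) - ((M : ℝ) + 1) * ε * n) := by
  have hq : (1 : ℝ) < Nat.card F := by exact_mod_cast Finite.one_lt_card
  have hM : (0 : ℝ) < (M : ℝ) + 1 := by positivity
  set x : ℝ := ((M : ℝ) / (M + 1) + ε) * n with hx
  have hxM : ((M : ℝ) + 1) * x = M * n + (M + 1) * ε * n := by
    rw [hx]
    field_simp
  -- If `⌊x⌋₊` exceeds `n`, no `p` exists, but the event is empty since the complexity is at most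
  -- `n`.
  rcases lt_or_ge n ⌊x⌋₊ with hn | hn
  · have hempty : {a : ℕ → Fin M → F | x < (linearComplexity a n : ℝ)} = ∅ :=
      Set.eq_empty_of_forall_notMem fun a ha => by
        have h1 : (linearComplexity a n : ℝ) ≤ n := Nat.cast_le.2 (linearComplexity_le a n)
        have h2 : (n : ℝ) < x := Nat.lt_of_lt_floor hn
        exact absurd (lt_trans h2 ha) (not_lt.2 h1)
    rw [hempty, measureReal_empty]
    positivity
  · obtain ⟨p, hp⟩ := Nat.exists_eq_add_of_le hn
    have h0 : 0 ≤ x := by positivity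
    have hsub : {a : ℕ → Fin M → F | x < (linearComplexity a n : ℝ)} ⊆
        {a | ¬ IsLFSRLength a (⌊x⌋₊ + p) ⌊x⌋₊} := fun a ha h => by
      rw [← hp, ← linearComplexity_le_iff, Nat.le_floor_iff h0] at h
      exact absurd ha (not_lt.2 h)
    refine (measureReal_mono hsub).trans ((haar_not_isLFSRLength_le _ _).trans
      (pow_div_pow_le_rpow hq ?_))
    have hpn : (n : ℝ) = ⌊x⌋₊ + p := by exact_mod_cast hp
    -- Rounding `x` down costs at most M + 1 in the exponent, hence the constant term of the bound.
    have := mul_le_mul_of_nonneg_left (Nat.lt_floor_add_one x).le hM.le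
    have hMp : (M : ℝ) * p = M * n - M * ⌊x⌋₊ := by rw [hpn]; ring
    push_cast
    linarith

end Haar

theorem theorem34 {F : Type*} [Field F] [Finite F] [TopologicalSpace F] [DiscreteTopology F]
    [MeasurableSpace F] [BorelSpace F] (M : ℕ) (hM : 1 ≤ M) :
    ∀ᵐ a ∂(haarMultisequence F M),
      Filter.Tendsto (fun n : ℕ => (linearComplexity a n : ℝ) / (n : ℝ)) Filter.atTop
        (nhds ((M : ℝ) / ((M : ℝ) + 1))) := by
  have hq : (1 : ℝ) < Nat.card F := by exact_mod_cast Finite.one_lt_card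
  have hM0 : (0 : ℝ) < (M : ℝ) + 1 := by positivity
  have hε : ∀ j : ℕ, (0 : ℝ) < ((M : ℝ) + 1) * (1 / ((j : ℝ) + 1)) := fun j => by positivity
  -- Restricting to ε = 1/(j+1) leaves countably many null sets to discard.
  have hlow := ae_all_iff.2 fun j : ℕ => ae_eventually_notMem_of_rpow_bound
    (haarMultisequence F M) hq (hε j) _ (haar_linearComplexity_lt_le (ε := 1 / ((j : ℝ) + 1)) (by positivity))
  have hupp := ae_all_iff.2 fun j : ℕ => ae_eventually_notMem_of_rpow_bound
    (haarMultisequence F M) hq (hε j) _ (haar_lt_linearComplexity_le (ε := 1 / ((j : ℝ) + 1)) (by positivity))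
  filter_upwards [hlow, hupp] with a hl hu
  rw [Metric.tendsto_atTop']
  intro ε hε
  obtain ⟨j, hj⟩ := exists_nat_one_div_lt hε
  obtain ⟨N, hN⟩ := eventually_atTop.1 ((hl j).and (hu j))
  refine ⟨N, fun n hn => ?_⟩
  obtain ⟨h1, h2⟩ := hN n hn.le
  simp only [not_lt] at h1 h2
  have hn0 : (0 : ℝ) < n := by exact_mod_cast Nat.zero_lt_of_lt hn
  rw [← le_div_iff₀ hn0] at h1
  rw [← div_le_iff₀ hn0] at h2
  rw [Real.dist_eq, abs_lt]
  constructor <;> linarith
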